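/- Let $\Omega$ be a compact metric space with its Borel $\sigma$-algebra and let $T:\Omega\to\Omega$ be a map with finite fibres. Let $\mathcal X$ be a Banach space of bounded Borel functions $\Omega\to\mathbb R$, with norm $\|\cdot\|$, such that: 1. $\mathcal X$ contains the constants and is closed under products, with $\|fg\|\le\|f\|\,\|g\|$; there is $C>0$ with $\|f\|\ge C\sup_\Omega|f|$ for all $f\in\mathcal X$; and $\log f\in\mathcal X$ whenever $f\in\mathcal X$ and $\inf_\Omega f>0$. 2. The maps $f\mapsto f\circ T$ and $f\mapsto\bigl(x\mapsto\sum_{T(y)=x}f(y)\bigr)$ are well-defined continuous operators $\mathcal X\to\mathcal X$. 3. For each $A\in\mathcal X$ let $\mathcal L_A f(x)=\sum_{T(y)=x}e^{A(y)}f(y)$ be the transfer operator on $\mathcal X$. Its dual $\mathcal L_A^*$ maps finite measures to finite measures, and there are a number $\lambda_A>0$ which is the maximal eigenvalue of $\mathcal L_A$, a function $h_A\in\mathcal X$ with $\inf_\Omega h_A>0$ and $\mathcal L_Ah_A=\lambda_Ah_A$, and a Borel probability measure $\nu_A$ with $\int\mathcal L_Af\,d\nu_A=\lambda_A\int f\,d\nu_A$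 for all $f\in\mathcal X$; moreover there are $D>0$ and $\delta\in(0,1)$ such that $\|\mathcal L_A^nf\|\le D\lambda_A^n(1-\delta)^n\|f\|$ for all $n\in\mathbb N$ and all $f\in\mathcal X$ with $\int f\,d\nu_A=0$. With $h_A$ normalized so that $\int h_A\,d\nu_A=1$, the probability measure $\mu_A=h_A\nu_A$ is called the Gibbs measure of $A$. 4. If $A,f\in\mathcal X$, $f\ge0$ and $\int f\,d\mu_A=0$, then $f=0$. 5. Every continuous function $\Omega\to\mathbb R$ is a uniform limit of elements of $\mathcal X$. Let $\mathcal C=\{g-g\circ T+c : g\in\mathcal X,\ c\in\mathbb R\}$. Given $\Phi=(\varphi_1,\dots,\varphi_K)\in\mathcal X^K$, put $\operatorname{rv}(\mu)=\bigl(\int\varphi_1\,d\mu,\dots,\int\varphi_K\,d\mu\bigr)\in\mathbb R^K$, and let $\operatorname{Rot}(\Phi)\subset\mathbb R^K$ be the set of the vectors $\operatorname{rv}(\mu)$ for all $T$-invariant Borel probability measures $\mu$. **Theorem.** Suppose that the classes $[\varphi_1],\dots,[\varphi_K]$ in $\mathcal X/\mathcal C$ are linearly independent. Then for every $B\in\mathcal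 X$ the map $$\mathbb R^K\to\operatorname{int}\operatorname{Rot}(\Phi),\qquad (a_1,\dots,a_K)\mapsto\operatorname{rv}\bigl(\mu_{B+a_1\varphi_1+\dots+a_K\varphi_K}\bigr)$$ is an analytic diffeomorphism (bijective, analytic, with analytic inverse). In particular $\operatorname{Rot}(\Phi)$ has non-empty interior, and every $w\in\operatorname{int}\operatorname{Rot}(\Phi)$ is the rotation vector of some $T$-invariant Gibbs measure $\mu_A$, $A\in\mathcal X$. -/

import Mathlib

open MeasureTheory

/-- A Banach algebra `X` of bounded Borel functions on `Ω`, on which the map `T : Ω → Ω` acts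
forward and backward.  The elements of `X` are identified with functions on `Ω` through the
injective algebra homomorphism `ev`; in particular `X` contains the constants and is closed under
pointwise products, and its norm is submultiplicative (`NormedCommRing`).  The two operators
`koopman` and `fibreSum` are determined by their values; their presence says that
`f ↦ f ∘ T` and `f ↦ (x ↦ ∑_{T y = x} f y)` are well defined and continuous on `X`. -/
structure PotentialSpace {Ω : Type*} [MeasurableSpace Ω] (T : Ω → Ω)
    (X : Type*) [NormedCommRing X] [NormedAlgebra ℝ X] where
  /-- the function on `Ω` represented by an element of `X` -/
  ev : X →ₐ[ℝ] (Ω → ℝ)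
  ev_injective : Function.Injective ev
  measurable_ev : ∀ f : X, Measurable (ev f)
  /-- the norm dominates the supremum norm (so all functions are bounded) -/
  exists_sup_le : ∃ C : ℝ, 0 < C ∧ ∀ (f : X) (x : Ω), C * |ev f x| ≤ ‖f‖
  /-- the logarithm of a function bounded away from zero from below is in the space -/
  exists_log : ∀ f : X, (∃ c : ℝ, 0 < c ∧ ∀ x, c ≤ ev f x) →
    ∃ g : X, ∀ x, ev g x = Real.log (ev f x)
  /-- the composition operator `f ↦ f ∘ T` -/
  koopman : X →L[ℝ] X
  koopman_apply : ∀ (f : X) (x : Ω), ev (koopman f) x = ev f (T x)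
  /-- the operator of summation over the fibres of `T` -/
  fibreSum : X →L[ℝ] X
  fibreSum_apply : ∀ (f : X) (x : Ω), ev (fibreSum f) x = ∑ᶠ y ∈ T ⁻¹' {x}, ev f y

namespace PotentialSpace

section

variable {Ω : Type*} [MeasurableSpace Ω] {T : Ω → Ω}
  {X : Type*} [NormedCommRing X] [NormedAlgebra ℝ X]

/-- The transfer operator `L_A f (x) = ∑_{T y = x} exp (A y) * f y`
(see `transfer_apply`). -/
noncomputable def transfer (S : PotentialSpace T X) (A : X) : X →L[ℝ] X :=
  S.fibreSum.comp (ContinuousLinearMap.mul ℝ X (NormedSpace.exp A))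

theorem ev_exp [CompleteSpace X] (S : PotentialSpace T X) (A : X) (x : Ω) :
    S.ev (NormedSpace.exp A) x = Real.exp (S.ev A x) := by
  let _ : NormedAlgebra ℚ X := NormedAlgebra.restrictScalars ℚ ℝ X
  obtain ⟨C, hC, hb⟩ := S.exists_sup_le
  let e : X →+* ℝ := (Pi.evalRingHom (fun _ : Ω => ℝ) x).comp S.ev.toRingHom
  have he : ∀ f, e f = S.ev f x := fun _ => rfl
  have hc : Continuous e := by
    refine AddMonoidHomClass.continuous_of_bound e C⁻¹ (fun f => ?_)
    rw [Real.norm_eq_abs, he, inv_mul_eq_div, le_div_iff₀ hC, mul_comm]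
    exact hb f x
  have h := NormedSpace.map_exp e hc A
  rw [he, he, ← Real.exp_eq_exp_ℝ] at h
  exact h

theorem transfer_apply [CompleteSpace X] (S : PotentialSpace T X) (A f : X) (x : Ω) :
    S.ev (S.transfer A f) x = ∑ᶠ y ∈ T ⁻¹' {x}, Real.exp (S.ev A y) * S.ev f y := by
  simp only [transfer, ContinuousLinearMap.comp_apply, fibreSum_apply,
    ContinuousLinearMap.mul_apply', map_mul, Pi.mul_apply, ev_exp]

/-- `lam`, `h`, `ν` are the leading eigenvalue of `L_A`, a positive eigenfunction bounded away
from zero, and an eigenprobability of the dual operator, with a spectral gap on the kernel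
of `ν`. -/
structure IsRPFTriple (S : PotentialSpace T X) (A : X) (lam : ℝ) (h : X) (ν : Measure Ω) :
    Prop where
  lam_pos : 0 < lam
  lam_max : ∀ (κ : ℝ) (f : X), f ≠ 0 → S.transfer A f = κ • f → |κ| ≤ lam
  h_pos : ∃ c : ℝ, 0 < c ∧ ∀ x, c ≤ S.ev h x
  transfer_h : S.transfer A h = lam • h
  prob : IsProbabilityMeasure ν
  dual_eigen : ∀ f : X, ∫ x, S.ev (S.transfer A f) x ∂ν = lam * ∫ x, S.ev f x ∂ν
  gap : ∃ D δ : ℝ, 0 < D ∧ 0 < δ ∧ δ < 1 ∧ ∀ (n : ℕ) (f : X), ∫ x, S.ev f x ∂ν = 0 →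
    ‖(S.transfer A ^ n) f‖ ≤ D * lam ^ n * (1 - δ) ^ n * ‖f‖

/-- The Ruelle-Perron-Frobenius hypothesis, with spectral gap: for every potential `A` the dual
of the transfer operator maps finite measures to finite measures, and there are leading
eigendata. -/
def SatisfiesRPF (S : PotentialSpace T X) : Prop :=
  ∀ A : X,
    (∀ m : Measure Ω, IsFiniteMeasure m → ∃ m' : Measure Ω, IsFiniteMeasure m' ∧
      ∀ f : X, ∫ x, S.ev (S.transfer A f) x ∂m = ∫ x, S.ev f x ∂m') ∧
    ∃ (lam : ℝ) (h : X) (ν : Measure Ω), S.IsRPFTriple A lam h ν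

/-- `μ` is the measure `h_A ν_A`, where `h_A` is normalized so that `μ` has mass one. -/
def IsGibbsMeasure (S : PotentialSpace T X) (A : X) (μ : Measure Ω) : Prop :=
  ∃ (lam : ℝ) (h : X) (ν : Measure Ω), S.IsRPFTriple A lam h ν ∧
    μ = ν.withDensity (fun x => ENNReal.ofReal (S.ev h x / ∫ z, S.ev h z ∂ν))

/-- The Gibbs measure `μ_A` of the potential `A`. -/
noncomputable def gibbsMeasure (S : PotentialSpace T X) (A : X) : Measure Ω :=
  Classical.epsilon (S.IsGibbsMeasure A)

theorem gibbsMeasure_spec (S : PotentialSpace T X) (hS : S.SatisfiesRPF) (A : X) :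
    S.IsGibbsMeasure A (S.gibbsMeasure A) := by
  obtain ⟨lam, h, ν, hA⟩ := (hS A).2
  exact Classical.epsilon_spec (p := S.IsGibbsMeasure A) ⟨_, lam, h, ν, hA, rfl⟩

/-- A non-negative function of the space whose integral against some Gibbs measure is zero
vanishes identically. -/
def GibbsFaithful (S : PotentialSpace T X) : Prop :=
  ∀ A f : X, (∀ x, 0 ≤ S.ev f x) → ∫ x, S.ev f x ∂(S.gibbsMeasure A) = 0 → f = 0

/-- Every continuous function is a uniform limit of functions of the space. -/
def ApproximatesContinuous [TopologicalSpace Ω] (S : PotentialSpace T X) : Prop :=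
  ∀ g : C(Ω, ℝ), ∀ ε : ℝ, 0 < ε → ∃ f : X, ∀ x, |S.ev f x - g x| ≤ ε

/-- The subspace of the functions `g - g ∘ T + c` with `g` in the space and `c` constant. -/
def coboundariesAndConstants (S : PotentialSpace T X) : Submodule ℝ X where
  carrier := {f | ∃ (g : X) (c : ℝ), ∀ x, S.ev f x = S.ev g x - S.ev g (T x) + c}
  zero_mem' := ⟨0, 0, fun x => by simp⟩
  add_mem' := by
    rintro f f' ⟨g, c, h⟩ ⟨g', c', h'⟩
    refine ⟨g + g', c + c', fun x => ?_⟩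
    simp only [map_add, Pi.add_apply, h, h']
    ring
  smul_mem' := by
    rintro r f ⟨g, c, h⟩
    refine ⟨r • g, r * c, fun x => ?_⟩
    simp only [map_smul, Pi.smul_apply, smul_eq_mul, h]
    ring

/-- The vector of the integrals of the test functions `φ 0, …, φ (K - 1)`. -/
noncomputable def rotationVector (S : PotentialSpace T X) {K : ℕ} (φ : Fin K → X)
    (μ : Measure Ω) : Fin K → ℝ :=
  fun k => ∫ x, S.ev (φ k) x ∂μ

end

end PotentialSpace

/-- The `T`-invariant Borel probability measures. -/
def invariantProbabilities {Ω : Type*} [MeasurableSpace Ω] (T : Ω → Ω) : Set (Measure Ω) :=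
  {μ | IsProbabilityMeasure μ ∧ MeasurePreserving T μ μ}

/-- The set `Rot Φ` of the rotation vectors of all `T`-invariant probability measures. -/
def PotentialSpace.rotationSet {Ω : Type*} [MeasurableSpace Ω] {T : Ω → Ω}
    {X : Type*} [NormedCommRing X] [NormedAlgebra ℝ X]
    (S : PotentialSpace T X) {K : ℕ} (φ : Fin K → X) : Set (Fin K → ℝ) :=
  S.rotationVector φ '' invariantProbabilities T

/-- `F` is an analytic diffeomorphism from `E` onto the open subset `U` of `E'`: it is analytic,
and has an analytic inverse `U → E`. -/
def IsAnalyticDiffeomorphismOnto {E E' : Type*} [NormedAddCommGroup E] [NormedSpace ℝ E]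
    [NormedAddCommGroup E'] [NormedSpace ℝ E'] (F : E → E') (U : Set E') : Prop :=
  IsOpen U ∧ AnalyticOnNhd ℝ F Set.univ ∧ (∀ a, F a ∈ U) ∧
    ∃ G : E' → E, AnalyticOnNhd ℝ G U ∧ (∀ a, G (F a) = a) ∧ ∀ w ∈ U, F (G w) = w

open scoped Topology

/-! ### Algebra of the transfer operator and the eigenmeasure as a functional. -/

namespace PotentialSpace

variable {Ω : Type*} [MeasurableSpace Ω] {T : Ω → Ω}
  {X : Type*} [NormedCommRing X] [NormedAlgebra ℝ X]

/-! The map is the gradient of a strictly convex analytic function. Let `P A = log λ_A` be the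
pressure. The spectral gap makes the linearized eigenfunction equation invertible, so by the
implicit function theorem `λ_A` and a local branch of eigenfunctions depend analytically on `A`
(`IsEigendata.exists_analyticAt_eigenpair`). Differentiating the eigenvalue equation gives `dP_A(f)
= ∫ f dμ_A` (`fderiv_pressure`), so `F(a) = rv(μ_{B + a·φ})` is the gradient of `a ↦ P(B + a·φ)`.

The second derivative of `P` along `f` is `∫ u² dμ_A`, with `u` equal to `f` up to a coboundary and
a constant (`hasDerivAt_integral_gibbsMeasure`). Faithfulness of `μ_A` and independence of the
classes make `dF` injective. Globally, `P` lies above its tangent planes, with equality only along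
`𝒞` (`pressure_add_integral_le`), so `F` is injective. Hence `F` is an analytic diffeomorphism onto
an open set, contained in `Rot Φ` because Gibbs measures are invariant.

Conversely, since `∫ A dμ ≤ P A` for invariant `μ`, the function `a ↦ P(B + a·φ) - a·w` is coercive
for `w` interior to `Rot Φ`; at its minimum `F(a) = w` (`interior_rotationSet_subset_range`). -/

theorem ext_ev (S : PotentialSpace T X) {f g : X} (h : ∀ x, S.ev f x = S.ev g x) : f = g :=
  S.ev_injective (funext h)

theorem exists_abs_ev_le (S : PotentialSpace T X) :
    ∃ C : ℝ, 0 < C ∧ ∀ (f : X) (x : Ω), |S.ev f x| ≤ C * ‖f‖ := by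
  obtain ⟨C, hC, hb⟩ := S.exists_sup_le
  refine ⟨C⁻¹, inv_pos.2 hC, fun f x => ?_⟩
  rw [inv_mul_eq_div, le_div_iff₀ hC, mul_comm]
  exact hb f x

theorem integrable_ev (S : PotentialSpace T X) (μ : Measure Ω) [IsFiniteMeasure μ] (f : X) :
    Integrable (S.ev f) μ := by
  obtain ⟨C, -, hb⟩ := S.exists_abs_ev_le
  exact Integrable.of_bound (S.measurable_ev f).aestronglyMeasurable (C * ‖f‖)
    (Filter.Eventually.of_forall fun x => hb f x)

/-- Integration against a finite measure, as a continuous functional on the space. -/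
noncomputable def integralCLM (S : PotentialSpace T X) (μ : Measure Ω) [IsFiniteMeasure μ] :
    X →L[ℝ] ℝ :=
  LinearMap.mkContinuousOfExistsBound
    { toFun := fun f => ∫ x, S.ev f x ∂μ
      map_add' := fun f g => by
        simp only [map_add, Pi.add_apply]
        exact integral_add (S.integrable_ev μ f) (S.integrable_ev μ g)
      map_smul' := fun r f => by
        simp only [map_smul, Pi.smul_apply, smul_eq_mul, RingHom.id_apply]
        exact integral_const_mul r _ }
    (by
      obtain ⟨C, -, hb⟩ := S.exists_abs_ev_le
      refine ⟨C * μ.real Set.univ, fun f => ?_⟩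
      have h := norm_integral_le_of_norm_le_const (μ := μ) (f := S.ev f)
        (Filter.Eventually.of_forall fun x => hb f x)
      exact h.trans_eq (by ring))

theorem integralCLM_apply (S : PotentialSpace T X) (μ : Measure Ω) [IsFiniteMeasure μ] (f : X) :
    S.integralCLM μ f = ∫ x, S.ev f x ∂μ := rfl

theorem koopman_mul (S : PotentialSpace T X) (f g : X) :
    S.koopman (f * g) = S.koopman f * S.koopman g :=
  S.ext_ev fun x => by simp [koopman_apply]

theorem transfer_eq (S : PotentialSpace T X) (A f : X) :
    S.transfer A f = S.fibreSum (NormedSpace.exp A * f) := rfl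

/-- On the fibre over `x` the function `f ∘ T` is constant, equal to `f x`, and factors out. -/
theorem fibreSum_mul_koopman (S : PotentialSpace T X) (f g : X) :
    S.fibreSum (S.koopman f * g) = f * S.fibreSum g := by
  refine S.ext_ev fun x => ?_
  simp only [fibreSum_apply, map_mul, Pi.mul_apply, koopman_apply]
  rw [← smul_eq_mul, smul_finsum]
  refine finsum_congr fun y => ?_
  rw [smul_finsum]
  refine finsum_congr fun hy => ?_
  rw [show T y = x from hy, smul_eq_mul]

theorem transfer_koopman_mul (S : PotentialSpace T X) (A f g : X) :
    S.transfer A (S.koopman f * g) = f * S.transfer A g := by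
  rw [transfer_eq, transfer_eq, mul_left_comm, fibreSum_mul_koopman]

theorem fibreSum_nonneg (S : PotentialSpace T X) {f : X} (hf : ∀ x, 0 ≤ S.ev f x) (x : Ω) :
    0 ≤ S.ev (S.fibreSum f) x := by
  rw [fibreSum_apply]
  exact finsum_nonneg fun y => finsum_nonneg fun _ => hf y

/-- Finite fibres are essential here: `finsum` is zero by default on an infinite support. -/
theorem le_fibreSum (S : PotentialSpace T X) (hT : ∀ x, (T ⁻¹' {x}).Finite) {f : X}
    (hf : ∀ x, 0 ≤ S.ev f x) (y : Ω) : S.ev f y ≤ S.ev (S.fibreSum f) (T y) := by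
  rw [fibreSum_apply, finsum_mem_eq_finite_toFinset_sum _ (hT _)]
  exact Finset.single_le_sum (f := S.ev f) (fun i _ => hf i) (by simp)

theorem eq_zero_of_fibreSum_eq_zero (S : PotentialSpace T X) (hT : ∀ x, (T ⁻¹' {x}).Finite)
    {f : X} (hf : ∀ x, 0 ≤ S.ev f x) (h : S.fibreSum f = 0) : f = 0 := by
  refine S.ext_ev fun y => le_antisymm ?_ ?_
  · simpa [h] using S.le_fibreSum hT hf y
  · simpa using hf y

theorem exists_exp_eq [CompleteSpace X] (S : PotentialSpace T X) {h : X}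
    (hh : ∃ c : ℝ, 0 < c ∧ ∀ x, c ≤ S.ev h x) : ∃ l : X, NormedSpace.exp l = h := by
  obtain ⟨l, hl⟩ := S.exists_log h hh
  obtain ⟨c, hc, hh⟩ := hh
  refine ⟨l, S.ext_ev fun x => ?_⟩
  rw [ev_exp, hl, Real.exp_log (hc.trans_le (hh x))]

theorem exp_mul_exp_neg [CompleteSpace X] (S : PotentialSpace T X) (l : X) :
    NormedSpace.exp l * NormedSpace.exp (-l) = 1 :=
  S.ext_ev fun x => by simp [ev_exp, ← Real.exp_add]

/-- Leading eigendata of the transfer operator, with the eigenmeasure seen as a functional on the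
space and with the eigenfunction normalized. -/
structure IsEigendata (S : PotentialSpace T X) (A : X) (lam : ℝ) (h : X) (m : X →L[ℝ] ℝ) :
    Prop where
  lam_pos : 0 < lam
  h_pos : ∃ c : ℝ, 0 < c ∧ ∀ x, c ≤ S.ev h x
  transfer_h : S.transfer A h = lam • h
  dual_eigen : ∀ f : X, m (S.transfer A f) = lam * m f
  map_h : m h = 1
  map_one : m 1 = 1
  nonneg : ∀ f : X, (∀ x, 0 ≤ S.ev f x) → 0 ≤ m f
  gap : ∃ D δ : ℝ, 0 < D ∧ 0 < δ ∧ δ < 1 ∧ ∀ (n : ℕ) (f : X), m f = 0 →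
    ‖(S.transfer A ^ n) f‖ ≤ D * lam ^ n * (1 - δ) ^ n * ‖f‖

theorem IsGibbsMeasure.exists_isEigendata {S : PotentialSpace T X} {A : X} {μ : Measure Ω}
    (hμ : S.IsGibbsMeasure A μ) :
    ∃ (lam : ℝ) (h : X) (m : X →L[ℝ] ℝ), S.IsEigendata A lam h m ∧
      ∀ f : X, ∫ x, S.ev f x ∂μ = m (h * f) := by
  obtain ⟨lam, h, ν, H, rfl⟩ := hμ
  have := H.prob
  obtain ⟨c, hc, hh⟩ := H.h_pos
  set r := ∫ z, S.ev h z ∂ν with hr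
  have hcr : c ≤ r := by
    have := integral_mono (μ := ν) (integrable_const c) (S.integrable_ev ν h) hh
    simpa using this
  have hr0 : 0 < r := hc.trans_le hcr
  refine ⟨lam, r⁻¹ • h, S.integralCLM ν, ⟨H.lam_pos, ⟨r⁻¹ * c, by positivity, fun x => ?_⟩, ?_,
    H.dual_eigen, ?_, ?_, fun f hf => integral_nonneg hf, H.gap⟩, fun f => ?_⟩
  · simp only [map_smul, Pi.smul_apply, smul_eq_mul]
    gcongr
    exact hh x
  · rw [map_smul, H.transfer_h, smul_comm]
  · rw [map_smul, integralCLM_apply, ← hr, smul_eq_mul, inv_mul_cancel₀ hr0.ne']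
  · simp [integralCLM_apply]
  · rw [integral_withDensity_eq_integral_toReal_smul
      ((S.measurable_ev h).div_const r).ennreal_ofReal (by simp), integralCLM_apply]
    refine integral_congr_ae (Filter.Eventually.of_forall fun x => ?_)
    have : 0 ≤ S.ev h x / r := div_nonneg (hc.le.trans (hh x)) hr0.le
    simp only [ENNReal.toReal_ofReal this, map_mul, map_smul, Pi.mul_apply, Pi.smul_apply,
      smul_eq_mul]
    ring

theorem IsGibbsMeasure.isProbabilityMeasure {S : PotentialSpace T X} {A : X} {μ : Measure Ω}
    (hμ : S.IsGibbsMeasure A μ) : IsProbabilityMeasure μ := by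
  obtain ⟨lam, h, m, H, hm⟩ := hμ.exists_isEigendata
  have h1 := hm 1
  rw [mul_one, H.map_h] at h1
  simp only [_root_.map_one, Pi.one_apply, integral_const, smul_eq_mul, mul_one] at h1
  -- An infinite mass would have real value zero by default, so the value one also gives finiteness.
  exact ⟨(ENNReal.toReal_eq_one_iff _).1 h1⟩

/-- This is the invariance of the Gibbs measure: apply the dual eigenvalue equation to `(f ∘ T) h`,
whose transfer is `lam • (f * h)`. -/
theorem IsEigendata.map_mul_koopman {S : PotentialSpace T X} {A h : X} {lam : ℝ}
    {m : X →L[ℝ] ℝ} (H : S.IsEigendata A lam h m) (f : X) :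
    m (h * S.koopman f) = m (h * f) := by
  have h1 := H.dual_eigen (S.koopman f * h)
  rw [transfer_koopman_mul, H.transfer_h, mul_smul_comm, map_smul, smul_eq_mul] at h1
  rw [mul_comm h, mul_comm h]
  exact (mul_left_cancel₀ H.lam_pos.ne' h1).symm

/-! ### Invariance of Gibbs measures. -/

section Topology

variable {Ω : Type*} [MetricSpace Ω] [MeasurableSpace Ω] [BorelSpace Ω]
  {T : Ω → Ω} {X : Type*} [NormedCommRing X] [NormedAlgebra ℝ X]

/-- For continuous `g`, the function `g ∘ T` is a limit of the measurable functions `u ∘ T` with `u`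
in the space. Distance functions then handle preimages of closed sets. -/
theorem measurable_of_approximatesContinuous (S : PotentialSpace T X)
    (hS : S.ApproximatesContinuous) : Measurable T := by
  have key (g : C(Ω, ℝ)) : Measurable fun x => g (T x) := by
    choose u hu using fun n : ℕ => hS g (1 / ((n : ℝ) + 1)) (by positivity)
    refine measurable_of_tendsto_metrizable (fun n => S.measurable_ev (S.koopman (u n))) ?_
    rw [tendsto_pi_nhds]
    intro x
    rw [tendsto_iff_dist_tendsto_zero]
    refine squeeze_zero (fun _ => dist_nonneg) (fun n => ?_)
      tendsto_one_div_add_atTop_nhds_zero_nat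
    rw [koopman_apply, Real.dist_eq]
    exact hu n (T x)
  refine measurable_of_isClosed fun s hs => ?_
  -- The distance to the empty set is zero by convention, so this case is separate.
  rcases s.eq_empty_or_nonempty with rfl | hne
  · simp
  have h := key ⟨fun x => Metric.infDist x s, Metric.continuous_infDist_pt s⟩
  have h2 : T ⁻¹' s = (fun x => Metric.infDist (T x) s) ⁻¹' {0} := by
    ext x
    exact hs.mem_iff_infDist_zero hne
  rw [h2]
  exact h (measurableSet_singleton 0)

theorem measure_eq_of_forall_integral_eq (S : PotentialSpace T X)
    (hS : S.ApproximatesContinuous) (μ μ' : Measure Ω) [IsProbabilityMeasure μ]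
    [IsProbabilityMeasure μ'] (h : ∀ f : X, ∫ x, S.ev f x ∂μ = ∫ x, S.ev f x ∂μ') : μ = μ' := by
  refine ext_of_forall_integral_eq_of_IsFiniteMeasure fun g => ?_
  have hb (f : X) (ε : ℝ) (hf : ∀ x, |S.ev f x - g x| ≤ ε) (ρ : Measure Ω)
      [IsProbabilityMeasure ρ] : |∫ x, S.ev f x ∂ρ - ∫ x, g x ∂ρ| ≤ ε := by
    rw [← integral_sub (S.integrable_ev ρ f) (g.integrable ρ)]
    have h := norm_integral_le_of_norm_le_const (μ := ρ) (f := fun x => S.ev f x - g x)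
      (Filter.Eventually.of_forall hf)
    simpa using h
  refine eq_of_forall_dist_le fun ε hε => ?_
  obtain ⟨f, hf⟩ := hS g.toContinuousMap (ε / 2) (by positivity)
  have h1 := hb f _ hf μ
  have h2 := hb f _ hf μ'
  rw [h f] at h1
  rw [Real.dist_eq]
  rw [abs_le] at *
  constructor <;> linarith

theorem IsGibbsMeasure.mem_invariantProbabilities {S : PotentialSpace T X}
    (hS : S.ApproximatesContinuous) {A : X} {μ : Measure Ω} (hμ : S.IsGibbsMeasure A μ) :
    μ ∈ invariantProbabilities T := by
  have hT := S.measurable_of_approximatesContinuous hS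
  have := hμ.isProbabilityMeasure
  refine ⟨this, hT, ?_⟩
  have := Measure.isProbabilityMeasure_map (μ := μ) hT.aemeasurable
  refine S.measure_eq_of_forall_integral_eq hS _ _ fun f => ?_
  obtain ⟨lam, h, m, H, hm⟩ := hμ.exists_isEigendata
  rw [integral_map hT.aemeasurable (S.measurable_ev f).aestronglyMeasurable, hm,
    ← H.map_mul_koopman, ← hm]
  simp only [koopman_apply]

end Topology

end PotentialSpace

/-! ### Invertibility by powers and the analytic implicit function theorem. -/

theorem isUnit_one_sub_of_norm_pow_lt_one {R : Type*} [NormedRing R] [CompleteSpace R] {x : R}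
    {n : ℕ} (h : ‖x ^ n‖ < 1) : IsUnit (1 - x) := by
  have h1 : IsUnit ((1 - x) * ∑ i ∈ Finset.range n, x ^ i) := by
    rw [mul_neg_geom_sum]
    exact isUnit_one_sub_of_norm_lt_one h
  have hc : Commute (1 - x) (∑ i ∈ Finset.range n, x ^ i) := by
    rw [Commute, SemiconjBy, mul_neg_geom_sum, geom_sum_mul_neg]
  exact (hc.isUnit_mul_iff.1 h1).1

/-- The implicit function theorem for analytic functions on Banach spaces. -/
theorem AnalyticAt.exists_implicitFunction {E F G : Type*} [NormedAddCommGroup E]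
    [NormedSpace ℝ E] [CompleteSpace E] [NormedAddCommGroup F] [NormedSpace ℝ F] [CompleteSpace F]
    [NormedAddCommGroup G] [NormedSpace ℝ G] [CompleteSpace G] {f : E × F → G} {a : E} {b : F}
    (hf : AnalyticAt ℝ f (a, b))
    (hb : Function.Bijective fun v : F => fderiv ℝ f (a, b) (0, v)) :
    ∃ g : E → F, AnalyticAt ℝ g a ∧ g a = b ∧ ∀ᶠ x in 𝓝 a, f (x, g x) = f (a, b) := by
  -- The derivative of `Ψ` is block triangular, hence invertible; `g` is read off from the local
  -- inverse along `x ↦ (x, f (a, b))`.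
  let Ψ : E × F → E × G := fun p => (p.1, f p)
  have hΨ : AnalyticAt ℝ Ψ (a, b) := analyticAt_fst.prod hf
  have hd : HasFDerivAt Ψ ((ContinuousLinearMap.fst ℝ E F).prod (fderiv ℝ f (a, b))) (a, b) :=
    hasFDerivAt_fst.prodMk hf.differentiableAt.hasFDerivAt
  have hdec (p : E × F) : fderiv ℝ f (a, b) p =
      fderiv ℝ f (a, b) (p.1, 0) + fderiv ℝ f (a, b) (0, p.2) := by
    rw [← map_add]; simp
  let i : (E × F) ≃L[ℝ] (E × G) := ContinuousLinearEquiv.ofBijective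
    ((ContinuousLinearMap.fst ℝ E F).prod (fderiv ℝ f (a, b)))
    (by
      rw [LinearMap.ker_eq_bot]
      intro p q hpq
      simp only [ContinuousLinearMap.coe_coe, ContinuousLinearMap.prod_apply,
        ContinuousLinearMap.coe_fst', Prod.mk.injEq] at hpq
      obtain ⟨h1, h2⟩ := hpq
      rw [hdec p, hdec q, h1, add_right_inj] at h2
      exact Prod.ext h1 (hb.1 h2))
    (by
      rw [LinearMap.range_eq_top]
      rintro ⟨x, y⟩
      obtain ⟨v, hv⟩ := hb.2 (y - fderiv ℝ f (a, b) (x, 0))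
      refine ⟨(x, v), ?_⟩
      have := hdec (x, v)
      simp only at hv this
      simp [this, hv])
  have hi : fderiv ℝ Ψ (a, b) = (i : E × F →L[ℝ] E × G) := by
    rw [hd.fderiv]
    exact (ContinuousLinearEquiv.coe_ofBijective _ _ _).symm
  have hs : HasStrictFDerivAt Ψ (i : E × F →L[ℝ] E × G) (a, b) := hi ▸ hΨ.hasStrictFDerivAt
  let e := hs.toOpenPartialHomeomorph
  have hesrc : (a, b) ∈ e.source := hs.mem_toOpenPartialHomeomorph_source
  have hea : AnalyticAt ℝ e.symm (Ψ (a, b)) := e.analyticAt_symm' hesrc hΨ hi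
  have hsymm : e.symm (Ψ (a, b)) = (a, b) := e.left_inv hesrc
  have hcurve : AnalyticAt ℝ (fun x : E => (x, f (a, b))) a := by fun_prop
  refine ⟨fun x => (e.symm (x, f (a, b))).2, ?_, ?_, ?_⟩
  · exact analyticAt_snd.comp (AnalyticAt.comp (f := fun x : E => (x, f (a, b))) hea hcurve)
  · exact congrArg Prod.snd hsymm
  · have hmem : ∀ᶠ x in 𝓝 a, (x, f (a, b)) ∈ e.target :=
      hcurve.continuousAt.eventually (e.open_target.mem_nhds (e.map_source hesrc))
    filter_upwards [hmem] with x hx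
    have h1 : Ψ (e.symm (x, f (a, b))) = (x, f (a, b)) := e.right_inv hx
    have h2 : (e.symm (x, f (a, b))).1 = x := congrArg Prod.fst h1
    have h3 : f (e.symm (x, f (a, b))) = f (a, b) := congrArg Prod.snd h1
    have h4 : (x, (e.symm (x, f (a, b))).2) = e.symm (x, f (a, b)) := Prod.ext h2.symm rfl
    rw [h4, h3]

/-! ### Analytic dependence of the leading eigendata. -/

namespace PotentialSpace

variable {Ω : Type*} [MeasurableSpace Ω] {T : Ω → Ω}
  {X : Type*} [NormedCommRing X] [NormedAlgebra ℝ X]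

theorem IsEigendata.map_pos {S : PotentialSpace T X} {A h k : X} {lam : ℝ}
    {m : X →L[ℝ] ℝ} (H : S.IsEigendata A lam h m) (hk : ∃ c : ℝ, 0 < c ∧ ∀ x, c ≤ S.ev k x) :
    0 < m k := by
  obtain ⟨c, hc, hk⟩ := hk
  have h1 := H.nonneg (k - c • 1) (fun x => by simpa using hk x)
  rw [map_sub, map_smul, H.map_one, smul_eq_mul, mul_one] at h1
  linarith

/-- Pair the equation with `m`, which is positive on `k`. This identifies the locally continued
eigenvalue with the leading one. -/
theorem IsEigendata.eigenvalue_eq {S : PotentialSpace T X} {A h k : X} {lam κ : ℝ}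
    {m : X →L[ℝ] ℝ} (H : S.IsEigendata A lam h m) (hk : ∃ c : ℝ, 0 < c ∧ ∀ x, c ≤ S.ev k x)
    (hκ : S.transfer A k = κ • k) : κ = lam := by
  have h1 := H.dual_eigen k
  rw [hκ, map_smul, smul_eq_mul] at h1
  exact mul_right_cancel₀ (H.map_pos hk).ne' h1

/-- The operator `N = lam⁻¹ L_A - m ⊗ h` maps into the kernel of `m` and equals `lam⁻¹ L_A` there,
so the gap makes its powers decay. -/
theorem IsEigendata.isUnit_one_sub [CompleteSpace X] {S : PotentialSpace T X} {A h : X} {lam : ℝ}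
    {m : X →L[ℝ] ℝ} (H : S.IsEigendata A lam h m) :
    IsUnit (1 - lam⁻¹ • (S.transfer A - lam • m.smulRight h)) := by
  set N : X →L[ℝ] X := lam⁻¹ • (S.transfer A - lam • m.smulRight h) with hN
  have hlam := H.lam_pos
  have hNf (f : X) : N f = lam⁻¹ • (S.transfer A f - lam • m f • h) := rfl
  have hmN (f : X) : m (N f) = 0 := by
    simp [hNf, H.dual_eigen, H.map_h]
  have hpow (n : ℕ) : ∀ f, m f = 0 → (N ^ n) f = (lam ^ n)⁻¹ • (S.transfer A ^ n) f := by
    induction n with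
    | zero => simp
    | succ n ih =>
      intro f hf
      have h1 : N f = lam⁻¹ • S.transfer A f := by simp [hNf, hf]
      rw [pow_succ, mul_apply_eq_comp, ih _ (hmN f), h1, map_smul, smul_smul,
        pow_succ (S.transfer A), mul_apply_eq_comp, pow_succ, mul_inv]
  obtain ⟨D, δ, hD, hδ, hδ1, hgap⟩ := H.gap
  -- The extra factor `N` first moves `f` into the kernel of `m`.
  have hbound (n : ℕ) : ‖N ^ (n + 1)‖ ≤ D * ‖N‖ * (1 - δ) ^ n := by
    have h0 : 0 ≤ 1 - δ := by linarith
    refine ContinuousLinearMap.opNorm_le_bound _ (by positivity) fun f => ?_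
    rw [pow_succ, mul_apply_eq_comp, hpow n _ (hmN f), norm_smul, norm_inv, norm_pow,
      Real.norm_of_nonneg hlam.le]
    have h1 := hgap n (N f) (hmN f)
    have h2 := N.le_opNorm f
    calc (lam ^ n)⁻¹ * ‖(S.transfer A ^ n) (N f)‖
        ≤ (lam ^ n)⁻¹ * (D * lam ^ n * (1 - δ) ^ n * (‖N‖ * ‖f‖)) := by
          gcongr
          exact h1.trans (by gcongr)
      _ = D * ‖N‖ * (1 - δ) ^ n * ‖f‖ := by field_simp
  have hlim : Filter.Tendsto (fun n : ℕ => D * ‖N‖ * (1 - δ) ^ n) Filter.atTop (𝓝 0) := by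
    simpa using (tendsto_pow_atTop_nhds_zero_of_lt_one (by linarith : (0 : ℝ) ≤ 1 - δ)
      (by linarith)).const_mul (D * ‖N‖)
  obtain ⟨n, hn⟩ := (hlim.eventually (gt_mem_nhds one_pos)).exists
  exact isUnit_one_sub_of_norm_pow_lt_one ((hbound n).trans_lt hn)

theorem eventually_pos (S : PotentialSpace T X) {h : X}
    (hh : ∃ c : ℝ, 0 < c ∧ ∀ x, c ≤ S.ev h x) :
    ∀ᶠ k in 𝓝 h, ∃ c : ℝ, 0 < c ∧ ∀ x, c ≤ S.ev k x := by
  obtain ⟨c, hc, hh⟩ := hh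
  obtain ⟨C, hC, hb⟩ := S.exists_abs_ev_le
  filter_upwards [Metric.ball_mem_nhds h (by positivity : 0 < c / (2 * C))] with k hk
  refine ⟨c / 2, by positivity, fun x => ?_⟩
  have h1 := hb (k - h) x
  rw [map_sub, Pi.sub_apply] at h1
  rw [Metric.mem_ball, dist_eq_norm, lt_div_iff₀ (by positivity)] at hk
  have h2 := neg_le_of_abs_le h1
  linarith [hh x]

theorem analyticAt_transfer [CompleteSpace X] (S : PotentialSpace T X) (p : X × X) :
    AnalyticAt ℝ (fun q : X × X => S.transfer q.1 q.2) p := by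
  have h1 : AnalyticAt ℝ (fun q : X × X => NormedSpace.exp q.1) p :=
    (NormedSpace.exp_analytic p.1).comp analyticAt_fst
  exact (S.fibreSum.analyticAt _).comp (h1.mul analyticAt_snd)

theorem IsEigendata.exists_analyticAt_eigenpair [CompleteSpace X] {S : PotentialSpace T X}
    {A h : X} {lam : ℝ} {m : X →L[ℝ] ℝ} (H : S.IsEigendata A lam h m) :
    ∃ (η : X → X) (κ : X → ℝ), AnalyticAt ℝ η A ∧ AnalyticAt ℝ κ A ∧ η A = h ∧
      ∀ᶠ A' in 𝓝 A, (∃ c : ℝ, 0 < c ∧ ∀ x, c ≤ S.ev (η A') x) ∧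
        S.transfer A' (η A') = κ A' • η A' := by
  -- With `m` kept fixed, a zero of `G` is an eigenfunction with eigenvalue `m (L k)`, so the
  -- eigenvalue is not a separate unknown. The partial derivative at `(A, h)` is `-lam (1 - N)`,
  -- with `N` as in `isUnit_one_sub`.
  let G : X × X → X := fun q => S.transfer q.1 q.2 - m (S.transfer q.1 q.2) • q.2
  have hlam := H.lam_pos
  have hG : AnalyticAt ℝ G (A, h) := by
    have h1 := S.analyticAt_transfer (A, h)
    exact h1.sub (((m.analyticAt _).comp h1).smul analyticAt_snd)
  have hL : HasFDerivAt (fun v : X => G (A, v))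
      (S.transfer A - (m (S.transfer A h) • ContinuousLinearMap.id ℝ X +
        (m.comp (S.transfer A)).smulRight h)) h :=
    (S.transfer A).hasFDerivAt.sub
      ((m.comp (S.transfer A)).hasFDerivAt.smul (hasFDerivAt_id h))
  have hL' : HasFDerivAt (fun v : X => G (A, v))
      ((fderiv ℝ G (A, h)).comp (ContinuousLinearMap.inr ℝ X X)) h :=
    HasFDerivAt.comp h hG.differentiableAt.hasFDerivAt (hasFDerivAt_prodMk_right A h)
  obtain ⟨U, hU⟩ := H.isUnit_one_sub
  have hder (v : X) : fderiv ℝ G (A, h) (0, v) = (-lam) • (U : X →L[ℝ] X) v := by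
    have := DFunLike.congr_fun (hL'.unique hL) v
    rw [hU]
    simp only [ContinuousLinearMap.comp_apply, ContinuousLinearMap.inr_apply] at this
    have h2 : m (S.transfer A h) = lam := by rw [H.dual_eigen, H.map_h, mul_one]
    have h3 : fderiv ℝ G (A, h) (0, v) =
        S.transfer A v - (lam • v + (lam * m v) • h) := by
      rw [this, h2, ← H.dual_eigen]; rfl
    have h4 : (1 - lam⁻¹ • (S.transfer A - lam • m.smulRight h)) v =
        v - lam⁻¹ • (S.transfer A v - lam • m v • h) := rfl
    rw [h3, h4, smul_sub, neg_smul, neg_smul, smul_inv_smul₀ hlam.ne', mul_smul]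
    abel
  have hbij : Function.Bijective fun v : X => fderiv ℝ G (A, h) (0, v) := by
    simp only [hder]
    refine Function.bijective_iff_has_inverse.2
      ⟨fun v => ((U⁻¹ : (X →L[ℝ] X)ˣ) : X →L[ℝ] X) ((-lam)⁻¹ • v), fun v => ?_, fun v => ?_⟩
    · simp only [smul_smul, inv_mul_cancel₀ (neg_ne_zero.2 hlam.ne'), one_smul]
      rw [← mul_apply_eq_comp, Units.inv_mul, one_apply_eq_self]
    · simp only
      rw [← mul_apply_eq_comp, Units.mul_inv, one_apply_eq_self,
        smul_smul, mul_inv_cancel₀ (neg_ne_zero.2 hlam.ne'), one_smul]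
  obtain ⟨η, hη, hηA, hev⟩ := hG.exists_implicitFunction hbij
  have hG0 : G (A, h) = 0 := by simp [G, H.transfer_h, H.map_h]
  refine ⟨η, fun A' => m (S.transfer A' (η A')), hη, ?_, hηA, ?_⟩
  · have h1 : AnalyticAt ℝ (fun A' => (A', η A')) A := analyticAt_id.prod hη
    exact (m.analyticAt _).comp
      (AnalyticAt.comp (f := fun A' => (A', η A')) (S.analyticAt_transfer (A, η A)) h1)
  · have hpos := hη.continuousAt.eventually (S.eventually_pos (hηA ▸ H.h_pos))
    filter_upwards [hev, hpos] with A' h1 h2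
    exact ⟨h2, sub_eq_zero.1 (h1.trans hG0)⟩

/-- The eigenvalue of the transfer operator with a positive eigenfunction. -/
noncomputable def leadingEigenvalue (S : PotentialSpace T X) (A : X) : ℝ :=
  Classical.epsilon fun lam => ∃ h : X, (∃ c : ℝ, 0 < c ∧ ∀ x, c ≤ S.ev h x) ∧
    S.transfer A h = lam • h

theorem IsEigendata.leadingEigenvalue_eq {S : PotentialSpace T X} {A h : X} {lam : ℝ}
    {m : X →L[ℝ] ℝ} (H : S.IsEigendata A lam h m) : S.leadingEigenvalue A = lam := by
  obtain ⟨k, hk, hκ⟩ := Classical.epsilon_spec (p := fun lam => ∃ h : X,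
    (∃ c : ℝ, 0 < c ∧ ∀ x, c ≤ S.ev h x) ∧ S.transfer A h = lam • h)
    ⟨lam, h, H.h_pos, H.transfer_h⟩
  exact H.eigenvalue_eq hk hκ

/-- The pressure of a potential: the logarithm of the leading eigenvalue. -/
noncomputable def pressure (S : PotentialSpace T X) (A : X) : ℝ :=
  Real.log (S.leadingEigenvalue A)

theorem exists_isEigendata (S : PotentialSpace T X) (hS : S.SatisfiesRPF) (A : X) :
    ∃ (h : X) (m : X →L[ℝ] ℝ), S.IsEigendata A (S.leadingEigenvalue A) h m ∧
      ∀ f : X, ∫ x, S.ev f x ∂(S.gibbsMeasure A) = m (h * f) := by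
  obtain ⟨lam, h, m, H, hm⟩ := (S.gibbsMeasure_spec hS A).exists_isEigendata
  rw [H.leadingEigenvalue_eq]
  exact ⟨h, m, H, hm⟩

theorem integral_koopman_gibbsMeasure (S : PotentialSpace T X) (hS : S.SatisfiesRPF) (A f : X) :
    ∫ x, S.ev (S.koopman f) x ∂(S.gibbsMeasure A) = ∫ x, S.ev f x ∂(S.gibbsMeasure A) := by
  obtain ⟨h, m, H, hm⟩ := S.exists_isEigendata hS A
  rw [hm, hm, H.map_mul_koopman]

theorem leadingEigenvalue_pos (S : PotentialSpace T X) (hS : S.SatisfiesRPF) (A : X) :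
    0 < S.leadingEigenvalue A := by
  obtain ⟨h, m, H, -⟩ := S.exists_isEigendata hS A
  exact H.lam_pos

theorem IsEigendata.exists_analyticAt_eigenfunction [CompleteSpace X] {S : PotentialSpace T X}
    (hS : S.SatisfiesRPF) {A h : X} {lam : ℝ} {m : X →L[ℝ] ℝ} (H : S.IsEigendata A lam h m) :
    AnalyticAt ℝ S.leadingEigenvalue A ∧ ∃ η : X → X, AnalyticAt ℝ η A ∧ η A = h ∧
      ∀ᶠ A' in 𝓝 A, S.transfer A' (η A') = S.leadingEigenvalue A' • η A' := by
  obtain ⟨η, κ, hη, hκ, hA, hev⟩ := H.exists_analyticAt_eigenpair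
  have hκ' : ∀ᶠ A' in 𝓝 A, κ A' = S.leadingEigenvalue A' := by
    filter_upwards [hev] with A' hA'
    obtain ⟨h', m', H', -⟩ := S.exists_isEigendata hS A'
    exact H'.eigenvalue_eq hA'.1 hA'.2
  refine ⟨hκ.congr hκ', η, hη, hA, ?_⟩
  filter_upwards [hev, hκ'] with A' h1 h2
  rw [h1.2, h2]

theorem analyticAt_leadingEigenvalue [CompleteSpace X] (S : PotentialSpace T X)
    (hS : S.SatisfiesRPF) (A : X) : AnalyticAt ℝ S.leadingEigenvalue A := by
  obtain ⟨h, m, H, -⟩ := S.exists_isEigendata hS A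
  exact (H.exists_analyticAt_eigenfunction hS).1

theorem analyticAt_pressure [CompleteSpace X] (S : PotentialSpace T X)
    (hS : S.SatisfiesRPF) (A : X) : AnalyticAt ℝ S.pressure A :=
  (analyticAt_log (S.leadingEigenvalue_pos hS A)).comp (S.analyticAt_leadingEigenvalue hS A)

end PotentialSpace

/-! ### Derivatives of the pressure: mean and variance. -/

namespace PotentialSpace

variable {Ω : Type*} [MeasurableSpace Ω] {T : Ω → Ω}
  {X : Type*} [NormedCommRing X] [NormedAlgebra ℝ X] [CompleteSpace X]

theorem hasDerivAt_exp_add_smul (A f : X) (t : ℝ) :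
    HasDerivAt (fun s : ℝ => NormedSpace.exp (A + s • f)) (NormedSpace.exp (A + t • f) * f) t := by
  have h1 : HasDerivAt (fun s : ℝ => A + s • f) f t := by
    simpa using ((hasDerivAt_id t).smul_const f).const_add A
  exact ((hasFDerivAt_exp (𝕂 := ℝ) (x := A + t • f)).comp_hasDerivAt t h1).congr_deriv
    (by simp)

/-- The eigendata at `A`, continued analytically along the line `t ↦ A + t • f`, with the
eigenvalue equation differentiated once near `t = 0` and twice at `t = 0`. -/
theorem IsEigendata.exists_derivatives {S : PotentialSpace T X} (hS : S.SatisfiesRPF) {A h : X}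
    {lam : ℝ} {m : X →L[ℝ] ℝ} (H : S.IsEigendata A lam h m) (f : X) :
    ∃ h' h'' : X,
      S.transfer A (f * h + h') = deriv (fun t : ℝ => S.leadingEigenvalue (A + t • f)) 0 • h +
        lam • h' ∧
      S.transfer A (f * f * h + (2 : ℝ) • (f * h') + h'') =
        deriv (deriv fun t : ℝ => S.leadingEigenvalue (A + t • f)) 0 • h +
        (2 * deriv (fun t : ℝ => S.leadingEigenvalue (A + t • f)) 0) • h' + lam • h'' := by
  obtain ⟨hk, η, hη, hA, hev⟩ := H.exists_analyticAt_eigenfunction hS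
  have hline : AnalyticAt ℝ (fun t : ℝ => A + t • f) 0 := by fun_prop
  have h0 : A + (0 : ℝ) • f = A := by simp
  set e : ℝ → X := fun t => η (A + t • f) with he
  set k : ℝ → ℝ := fun t => S.leadingEigenvalue (A + t • f) with hkdef
  have hea : AnalyticAt ℝ e 0 :=
    AnalyticAt.comp (f := fun t : ℝ => A + t • f) (h0.symm ▸ hη) hline
  have hka : AnalyticAt ℝ k 0 :=
    AnalyticAt.comp (g := S.leadingEigenvalue) (f := fun t : ℝ => A + t • f)
      (h0.symm ▸ hk) hline
  have he0 : e 0 = h := by rw [he]; simp only [h0, hA]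
  have hk0 : k 0 = lam := by rw [hkdef]; simp only [h0, H.leadingEigenvalue_eq]
  have heq : ∀ᶠ t in 𝓝 (0 : ℝ), S.fibreSum (NormedSpace.exp (A + t • f) * e t) = k t • e t := by
    have hc := hline.continuousAt
    rw [ContinuousAt, h0] at hc
    exact hc.eventually hev
  -- The first derivative is needed on a neighbourhood, so that it can be differentiated again.
  have heq1 : ∀ᶠ t in 𝓝 (0 : ℝ),
      S.fibreSum (NormedSpace.exp (A + t • f) * f * e t + NormedSpace.exp (A + t • f) * deriv e t)
        = k t • deriv e t + deriv k t • e t := by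
    filter_upwards [heq.eventually_nhds, hea.eventually_analyticAt, hka.eventually_analyticAt]
      with t h1 h2 h3
    have hd1 := S.fibreSum.hasFDerivAt.comp_hasDerivAt t
      ((hasDerivAt_exp_add_smul A f t).mul h2.differentiableAt.hasDerivAt)
    have hd2 := h3.differentiableAt.hasDerivAt.smul h2.differentiableAt.hasDerivAt
    exact (hd1.congr_of_eventuallyEq (h1.mono fun _ h => h.symm)).unique hd2
  have hd1 := S.fibreSum.hasFDerivAt.comp_hasDerivAt (0 : ℝ)
    ((((hasDerivAt_exp_add_smul A f 0).mul_const f).mul hea.differentiableAt.hasDerivAt).add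
      ((hasDerivAt_exp_add_smul A f 0).mul hea.deriv.differentiableAt.hasDerivAt))
  have hd2 := (hka.differentiableAt.hasDerivAt.smul hea.deriv.differentiableAt.hasDerivAt).add
    (hka.deriv.differentiableAt.hasDerivAt.smul hea.differentiableAt.hasDerivAt)
  have hsec := (hd1.congr_of_eventuallyEq (heq1.mono fun _ h => h.symm)).unique hd2
  have hfst := heq1.self_of_nhds
  rw [h0, he0, hk0] at hfst hsec
  refine ⟨deriv e 0, deriv (deriv e) 0, ?_, ?_⟩
  · rw [transfer_eq, add_comm (_ • h), ← hfst]
    congr 1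
    ring
  · rw [transfer_eq, mul_smul, two_smul, two_smul]
    convert hsec using 1
    · congr 1
      ring
    · abel

/-- Apply `m` to the once differentiated eigenvalue equation: the terms in `h'` cancel. -/
theorem hasDerivAt_leadingEigenvalue (S : PotentialSpace T X) (hS : S.SatisfiesRPF) (A f : X) :
    HasDerivAt (fun t : ℝ => S.leadingEigenvalue (A + t • f))
      (S.leadingEigenvalue A * ∫ x, S.ev f x ∂(S.gibbsMeasure A)) 0 := by
  obtain ⟨h, m, H, hm⟩ := S.exists_isEigendata hS A
  obtain ⟨h', h'', h1, -⟩ := H.exists_derivatives hS f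
  have hd : DifferentiableAt ℝ (fun t : ℝ => S.leadingEigenvalue (A + t • f)) 0 := by
    refine DifferentiableAt.comp (f := fun t : ℝ => A + t • f) (0 : ℝ)
      (S.analyticAt_leadingEigenvalue hS _).differentiableAt (by fun_prop)
  have h2 := congrArg m h1
  simp only [H.dual_eigen, map_add, map_smul, H.map_h, smul_eq_mul, mul_one] at h2
  have h3 : S.leadingEigenvalue A * ∫ x, S.ev f x ∂(S.gibbsMeasure A) =
      deriv (fun t : ℝ => S.leadingEigenvalue (A + t • f)) 0 := by
    rw [hm, mul_comm h f]
    linarith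
  rw [h3]
  exact hd.hasDerivAt

theorem deriv_leadingEigenvalue (S : PotentialSpace T X) (hS : S.SatisfiesRPF) (A f : X) (t : ℝ) :
    deriv (fun t : ℝ => S.leadingEigenvalue (A + t • f)) t =
      S.leadingEigenvalue (A + t • f) * ∫ x, S.ev f x ∂(S.gibbsMeasure (A + t • f)) := by
  rw [← (S.hasDerivAt_leadingEigenvalue hS (A + t • f) f).deriv]
  have h := deriv_comp_const_add (f := fun s : ℝ => S.leadingEigenvalue (A + s • f)) t 0
  rw [add_zero] at h
  rw [← h]
  congr 1
  ext s
  rw [add_smul, add_assoc]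

theorem fderiv_pressure (S : PotentialSpace T X) (hS : S.SatisfiesRPF) (A f : X) :
    fderiv ℝ S.pressure A f = ∫ x, S.ev f x ∂(S.gibbsMeasure A) := by
  have hpos := S.leadingEigenvalue_pos hS A
  have h0 : A + (0 : ℝ) • f = A := by simp
  have hline : HasDerivAt (fun s : ℝ => A + s • f) f 0 := by
    simpa using ((hasDerivAt_id (0 : ℝ)).smul_const f).const_add A
  have h1 : HasDerivAt (fun t : ℝ => S.pressure (A + t • f)) (fderiv ℝ S.pressure A f) 0 := by
    have h3 := (S.analyticAt_pressure hS A).differentiableAt.hasFDerivAt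
    nth_rw 2 [← h0] at h3
    exact h3.comp_hasDerivAt (0 : ℝ) hline
  have h2 := (S.hasDerivAt_leadingEigenvalue hS A f).log (by rw [h0]; exact hpos.ne')
  rw [h0, mul_div_cancel_left₀ _ hpos.ne'] at h2
  exact h1.unique h2

/-- The derivative of the mean of `f` in direction `f` is a variance: the integral of the square
of a function that differs from `f` by a coboundary and a constant. -/
theorem hasDerivAt_integral_gibbsMeasure (S : PotentialSpace T X) (hS : S.SatisfiesRPF)
    (A f : X) : ∃ (w : X) (c : ℝ),
      HasDerivAt (fun t : ℝ => ∫ x, S.ev f x ∂(S.gibbsMeasure (A + t • f)))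
        (∫ x, S.ev ((f - c • 1 + w - S.koopman w) ^ 2) x ∂(S.gibbsMeasure A)) 0 := by
  obtain ⟨h, m, H, hm⟩ := S.exists_isEigendata hS A
  obtain ⟨h', h'', h1, h2⟩ := H.exists_derivatives hS f
  have h0 : A + (0 : ℝ) • f = A := by simp
  have hlam := H.lam_pos
  obtain ⟨l, hl⟩ := S.exists_exp_eq H.h_pos
  set c := ∫ x, S.ev f x ∂(S.gibbsMeasure A) with hc
  set lam := S.leadingEigenvalue A with hlamdef
  have hk1 : deriv (fun t : ℝ => S.leadingEigenvalue (A + t • f)) 0 = lam * c := by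
    rw [S.deriv_leadingEigenvalue hS, h0]
  rw [hk1] at h1 h2
  set k2 := deriv (deriv fun t : ℝ => S.leadingEigenvalue (A + t • f)) 0
  obtain ⟨w, hw⟩ : ∃ w, h' = h * w := ⟨NormedSpace.exp (-l) * h', by
    rw [← hl, ← mul_assoc, S.exp_mul_exp_neg, one_mul]⟩
  subst hw
  refine ⟨w, c, ?_⟩
  set u := f - c • 1 + w - S.koopman w with hu
  have hcm : c = m (h * f) := hm f
  -- The choice `w = h' / h` turns the first-order equation into this identity. It makes `u`
  -- orthogonal to every `g ∘ T` in `L²(μ_A)`, which kills the cross term in `u ^ 2`.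
  have hLu : S.transfer A (h * u) = 0 := by
    have h3 : h * u = (f * h + h * w) - c • h - S.koopman w * h := by
      rw [hu, mul_sub, mul_add, mul_sub, mul_smul_comm, mul_one]
      ring
    rw [h3, map_sub, map_sub, h1, transfer_koopman_mul, map_smul, H.transfer_h, mul_smul_comm,
      smul_smul, mul_comm c lam, mul_comm w h]
    abel
  have hort : m (h * u * S.koopman w) = 0 := by
    have h3 := H.dual_eigen (S.koopman w * (h * u))
    rw [transfer_koopman_mul, hLu, mul_zero, map_zero, mul_comm (S.koopman w)] at h3
    exact (mul_eq_zero.1 h3.symm).resolve_left hlam.ne'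
  have hinv : m (h * (S.koopman w * S.koopman w)) = m (h * (w * w)) := by
    rw [← koopman_mul, H.map_mul_koopman]
  have hsq : m (h * u ^ 2) = m (f * f * h) + 2 * m (f * (h * w)) - 2 * c * m (h * w) - c ^ 2 := by
    have h3 : h * u ^ 2 = f * f * h + (2 : ℝ) • (f * (h * w)) - (2 * c) • (h * w)
        - (2 * c) • (h * f) + (c ^ 2) • h + h * (w * w) - (2 : ℝ) • (h * u * S.koopman w)
        - h * (S.koopman w * S.koopman w) := by
      have hu' : u = f - algebraMap ℝ X c + w - S.koopman w := by
        rw [hu, Algebra.algebraMap_eq_smul_one]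
      simp only [Algebra.smul_def, map_mul, map_pow, map_ofNat]
      rw [hu']
      ring
    rw [h3]
    simp only [map_add, map_sub, map_smul, smul_eq_mul, hort, hinv, H.map_h, ← hcm]
    ring
  have h4 := congrArg m h2
  simp only [H.dual_eigen, map_add, map_smul, H.map_h, smul_eq_mul, mul_one] at h4
  have hka : AnalyticAt ℝ (fun t : ℝ => S.leadingEigenvalue (A + t • f)) 0 :=
    AnalyticAt.comp (f := fun t : ℝ => A + t • f) (S.analyticAt_leadingEigenvalue hS _)
      (by fun_prop)
  have hpos (t : ℝ) := S.leadingEigenvalue_pos hS (A + t • f)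
  have hd := hka.deriv.differentiableAt.hasDerivAt.div hka.differentiableAt.hasDerivAt
    (hpos 0).ne'
  have hfun : (fun t : ℝ => ∫ x, S.ev f x ∂(S.gibbsMeasure (A + t • f))) =
      fun t => deriv (fun t : ℝ => S.leadingEigenvalue (A + t • f)) t /
        S.leadingEigenvalue (A + t • f) := by
    ext t
    rw [S.deriv_leadingEigenvalue hS, mul_div_cancel_left₀ _ (hpos t).ne']
  rw [hfun]
  refine hd.congr_deriv ?_
  rw [hm, hsq, hk1, h0, ← hlamdef, div_eq_iff (by positivity)]
  change k2 * lam - lam * c * (lam * c) = _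
  linear_combination (-lam) * h4

end PotentialSpace

/-! ### Normalized potentials and the Gibbs inequality. -/

namespace PotentialSpace

variable {Ω : Type*} [MeasurableSpace Ω] {T : Ω → Ω}
  {X : Type*} [NormedCommRing X] [NormedAlgebra ℝ X] [CompleteSpace X]

/-- A potential is, up to a coboundary and a constant, a potential whose transfer operator fixes
the constants and whose dual transfer operator fixes the Gibbs measure. -/
theorem exists_normalized_potential (S : PotentialSpace T X) (hS : S.SatisfiesRPF) (A : X) :
    ∃ l g : X, g = A + l - S.koopman l - S.pressure A • 1 ∧
      S.fibreSum (NormedSpace.exp g) = 1 ∧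
      ∀ f : X, ∫ x, S.ev (S.fibreSum (NormedSpace.exp g * f)) x ∂(S.gibbsMeasure A) =
        ∫ x, S.ev f x ∂(S.gibbsMeasure A) := by
  obtain ⟨h, m, H, hm⟩ := S.exists_isEigendata hS A
  obtain ⟨l, rfl⟩ := S.exists_exp_eq H.h_pos
  have hlam := H.lam_pos
  -- With `h = exp l`, this is the classical weight `exp A * h / (lam * h ∘ T)`.
  have hg : NormedSpace.exp (A + l - S.koopman l - S.pressure A • 1) =
      (S.leadingEigenvalue A)⁻¹ •
        (S.koopman (NormedSpace.exp (-l)) * (NormedSpace.exp A * NormedSpace.exp l)) := by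
    refine S.ext_ev fun x => ?_
    simp only [ev_exp, map_sub, map_add, map_smul, _root_.map_one, Pi.sub_apply, Pi.add_apply,
      Pi.smul_apply, Pi.one_apply, smul_eq_mul, mul_one, map_mul, Pi.mul_apply, koopman_apply,
      map_neg, Pi.neg_apply, Real.exp_sub, Real.exp_add, Real.exp_neg, pressure,
      Real.exp_log hlam]
    field_simp
  have hfib (f : X) :
      S.fibreSum (NormedSpace.exp (A + l - S.koopman l - S.pressure A • 1) * f) =
      (S.leadingEigenvalue A)⁻¹ •
        (NormedSpace.exp (-l) * S.transfer A (NormedSpace.exp l * f)) := by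
    rw [hg, smul_mul_assoc, map_smul, mul_assoc, fibreSum_mul_koopman, mul_assoc, transfer_eq]
  refine ⟨l, _, rfl, ?_, fun f => ?_⟩
  · rw [← mul_one (NormedSpace.exp _), hfib, mul_one, H.transfer_h, mul_smul_comm,
      inv_smul_smul₀ hlam.ne', mul_comm, S.exp_mul_exp_neg]
  · rw [hfib, hm, hm, mul_smul_comm, ← mul_assoc, S.exp_mul_exp_neg, one_mul, map_smul,
      H.dual_eigen, smul_eq_mul, inv_mul_cancel_left₀ hlam.ne']

/-- The weights `exp g` are positive with sum one on each fibre, so `g ≤ 0`. Integrating against an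
invariant measure removes the coboundary. -/
theorem integral_le_pressure (S : PotentialSpace T X) (hS : S.SatisfiesRPF)
    (hT : ∀ x, (T ⁻¹' {x}).Finite) (A : X) {μ : Measure Ω} (hμ : μ ∈ invariantProbabilities T) :
    ∫ x, S.ev A x ∂μ ≤ S.pressure A := by
  obtain ⟨hμ1, hμ2⟩ := hμ
  obtain ⟨l, g, hg, h1, -⟩ := S.exists_normalized_potential hS A
  have hg0 (x : Ω) : S.ev g x ≤ 0 := by
    have h2 := S.le_fibreSum hT (f := NormedSpace.exp g)
      (fun x => by rw [ev_exp]; exact (Real.exp_pos _).le) x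
    rw [h1, ev_exp, _root_.map_one, Pi.one_apply] at h2
    exact Real.exp_le_one_iff.1 h2
  have hinv : S.integralCLM μ (S.koopman l) = S.integralCLM μ l := by
    simp only [integralCLM_apply, koopman_apply]
    have h2 := integral_map (μ := μ) hμ2.measurable.aemeasurable
      (S.measurable_ev l).aestronglyMeasurable
    rw [hμ2.map_eq] at h2
    exact h2.symm
  have hone : S.integralCLM μ 1 = 1 := by simp [integralCLM_apply]
  have h3 : S.integralCLM μ g ≤ 0 := integral_nonpos hg0
  rw [hg, map_sub, map_sub, map_add, map_smul, hinv, hone, smul_eq_mul, integralCLM_apply] at h3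
  linarith

/-- The Gibbs inequality: the pressure lies above its tangent planes, which touch it only along
the coboundaries and constants. -/
theorem pressure_add_integral_le (S : PotentialSpace T X) (hS : S.SatisfiesRPF)
    (hT : ∀ x, (T ⁻¹' {x}).Finite) (hpos : S.GibbsFaithful) (A A' : X) :
    S.pressure A + ∫ x, S.ev (A' - A) x ∂(S.gibbsMeasure A) ≤ S.pressure A' ∧
      (S.pressure A + ∫ x, S.ev (A' - A) x ∂(S.gibbsMeasure A) = S.pressure A' →
        A' - A ∈ S.coboundariesAndConstants) := by
  have := (S.gibbsMeasure_spec hS A).isProbabilityMeasure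
  obtain ⟨l, g, hg, hg1, hgm⟩ := S.exists_normalized_potential hS A
  obtain ⟨l', g', hg', hg1', -⟩ := S.exists_normalized_potential hS A'
  -- With `t = g' - g` this is `exp g * (exp t - 1 - t) ≥ 0`, zero only where `t = 0`. Under the
  -- fibre sum the two pure exponentials cancel, and the mean of the rest is the gap in the
  -- inequality.
  set D := NormedSpace.exp g * (g - g') + NormedSpace.exp g' - NormedSpace.exp g with hD
  have hDev (x : Ω) : S.ev D x = Real.exp (S.ev g x) *
      (Real.exp (S.ev g' x - S.ev g x) - (S.ev g' x - S.ev g x + 1)) := by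
    simp only [hD, map_sub, map_add, map_mul, Pi.sub_apply, Pi.add_apply, Pi.mul_apply, ev_exp,
      Real.exp_sub]
    field_simp
    ring
  have hD0 (x : Ω) : 0 ≤ S.ev D x := by
    rw [hDev]
    exact mul_nonneg (Real.exp_pos _).le (sub_nonneg.2 (Real.add_one_le_exp _))
  have hint : ∫ x, S.ev (S.fibreSum D) x ∂(S.gibbsMeasure A) =
      S.pressure A' - (S.pressure A + ∫ x, S.ev (A' - A) x ∂(S.gibbsMeasure A)) := by
    have h1 : S.fibreSum D = S.fibreSum (NormedSpace.exp g * (g - g')) := by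
      rw [hD, map_sub, map_add, hg1, hg1']
      abel
    have hone : S.integralCLM (S.gibbsMeasure A) 1 = 1 := by simp [integralCLM_apply]
    have hk (f : X) : S.integralCLM (S.gibbsMeasure A) (S.koopman f) =
        S.integralCLM (S.gibbsMeasure A) f := S.integral_koopman_gibbsMeasure hS A f
    rw [h1, hgm, ← integralCLM_apply, ← integralCLM_apply, hg, hg']
    simp only [map_sub, map_add, map_smul, hone, hk, smul_eq_mul]
    ring
  have hfib := S.fibreSum_nonneg hD0
  refine ⟨sub_nonneg.1 (hint ▸ integral_nonneg hfib), fun heq => ?_⟩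
  have hz := S.eq_zero_of_fibreSum_eq_zero hT hD0
    (hpos A _ hfib (by rw [hint, heq, sub_self]))
  refine ⟨l - l', S.pressure A' - S.pressure A, fun x => ?_⟩
  have h1 := hDev x
  rw [hz, map_zero, Pi.zero_apply, eq_comm, mul_eq_zero, or_iff_right (Real.exp_pos _).ne',
    sub_eq_zero] at h1
  have h2 : S.ev g' x - S.ev g x = 0 := by
    by_contra hne
    exact (Real.add_one_lt_exp hne).ne' h1
  rw [hg, hg'] at h2
  simp only [map_sub, map_add, map_smul, _root_.map_one, Pi.sub_apply, Pi.add_apply,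
      Pi.smul_apply, Pi.one_apply, smul_eq_mul, mul_one, koopman_apply] at h2 ⊢
  linarith

end PotentialSpace

/-! ### From injective derivative to diffeomorphism. -/

theorem isAnalyticDiffeomorphismOnto_range {E : Type*} [NormedAddCommGroup E] [NormedSpace ℝ E]
    [FiniteDimensional ℝ E] {F : E → E} (hF : ∀ a, AnalyticAt ℝ F a) (hinj : F.Injective)
    (hd : ∀ a v, fderiv ℝ F a v = 0 → v = 0) : IsAnalyticDiffeomorphismOnto F (Set.range F) := by
  have := FiniteDimensional.complete ℝ E
  have hi (a : E) : ∃ i : E ≃L[ℝ] E, fderiv ℝ F a = (i : E →L[ℝ] E) :=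
    ⟨(LinearEquiv.ofInjectiveEndo (fderiv ℝ F a : E →ₗ[ℝ] E)
      ((injective_iff_map_eq_zero _).2 (hd a))).toContinuousLinearEquiv, by ext; rfl⟩
  choose i hi using hi
  have hs (a : E) : HasStrictFDerivAt F (i a : E →L[ℝ] E) a := hi a ▸ (hF a).hasStrictFDerivAt
  refine ⟨(isOpenMap_of_hasStrictFDerivAt_equiv hs).isOpen_range, fun a _ => hF a,
    Set.mem_range_self, Function.invFun F, ?_, Function.leftInverse_invFun hinj, ?_⟩
  · rintro _ ⟨a, rfl⟩
    let e := (hs a).toOpenPartialHomeomorph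
    have hesrc : a ∈ e.source := (hs a).mem_toOpenPartialHomeomorph_source
    have hea : AnalyticAt ℝ e.symm (F a) := e.analyticAt_symm' hesrc (hF a) (hi a)
    -- By injectivity the global inverse agrees with the analytic local inverse near `F a`.
    refine hea.congr ?_
    filter_upwards [e.open_target.mem_nhds (e.map_source hesrc)] with y hy
    have h1 : F (e.symm y) = y := e.right_inv hy
    nth_rw 2 [← h1]
    exact (Function.leftInverse_invFun hinj _).symm
  · rintro _ ⟨a, rfl⟩
    rw [Function.leftInverse_invFun hinj]

/-! ### The finite-dimensional family of Gibbs measures. -/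

namespace PotentialSpace

section

variable {Ω : Type*} [MeasurableSpace Ω] {T : Ω → Ω}
  {X : Type*} [NormedCommRing X] [NormedAlgebra ℝ X]

theorem integral_ev_sum_smul (S : PotentialSpace T X) (μ : Measure Ω) [IsFiniteMeasure μ] {K : ℕ}
    (φ : Fin K → X) (v : Fin K → ℝ) :
    ∫ x, S.ev (∑ k, v k • φ k) x ∂μ = ∑ k, v k * S.rotationVector φ μ k := by
  rw [← integralCLM_apply, map_sum]
  simp only [map_smul, smul_eq_mul, rotationVector, integralCLM_apply]

theorem eq_zero_of_sum_smul_mem (S : PotentialSpace T X) {K : ℕ} {φ : Fin K → X}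
    (hφ : LinearIndependent ℝ (fun k => S.coboundariesAndConstants.mkQ (φ k))) {v : Fin K → ℝ}
    (hv : ∑ k, v k • φ k ∈ S.coboundariesAndConstants) : v = 0 := by
  refine funext (Fintype.linearIndependent_iff.1 hφ v ?_)
  rw [← Submodule.ker_mkQ S.coboundariesAndConstants, LinearMap.mem_ker, map_sum] at hv
  simpa only [map_smul] using hv

variable [CompleteSpace X]

theorem hasFDerivAt_pressure_family (S : PotentialSpace T X) (hS : S.SatisfiesRPF) {K : ℕ}
    (φ : Fin K → X) (B : X) (a : Fin K → ℝ) :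
    ∃ P' : (Fin K → ℝ) →L[ℝ] ℝ,
      HasFDerivAt (fun a : Fin K → ℝ => S.pressure (B + ∑ k, a k • φ k)) P' a ∧
      ∀ v, P' v =
        ∑ k, v k * S.rotationVector φ (S.gibbsMeasure (B + ∑ k, a k • φ k)) k := by
  have := (S.gibbsMeasure_spec hS (B + ∑ k, a k • φ k)).isProbabilityMeasure
  let L : (Fin K → ℝ) →L[ℝ] X :=
    ∑ k, (ContinuousLinearMap.proj (R := ℝ) (φ := fun _ : Fin K => ℝ) k).smulRight (φ k)
  have hL (a : Fin K → ℝ) : L a = ∑ k, a k • φ k := by simp [L]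
  have h1 : HasFDerivAt (fun a : Fin K → ℝ => B + ∑ k, a k • φ k) L a := by
    simp only [← hL]
    exact L.hasFDerivAt.const_add B
  refine ⟨_, (S.analyticAt_pressure hS _).differentiableAt.hasFDerivAt.comp a h1, fun v => ?_⟩
  rw [ContinuousLinearMap.comp_apply, hL, fderiv_pressure S hS, integral_ev_sum_smul]

theorem analyticAt_rotationVector_gibbsMeasure (S : PotentialSpace T X) (hS : S.SatisfiesRPF)
    {K : ℕ} (φ : Fin K → X) (B : X) (a : Fin K → ℝ) :
    AnalyticAt ℝ (fun a : Fin K → ℝ =>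
      S.rotationVector φ (S.gibbsMeasure (B + ∑ k, a k • φ k))) a := by
  refine AnalyticAt.pi fun k => ?_
  simp only [rotationVector, ← S.fderiv_pressure hS]
  have h1 : AnalyticAt ℝ (fun a : Fin K → ℝ => B + ∑ k, a k • φ k) a :=
    analyticAt_const.add (Finset.analyticAt_fun_sum _ fun k _ => AnalyticAt.smul
      ((ContinuousLinearMap.proj (R := ℝ) (φ := fun _ : Fin K => ℝ) k).analyticAt a)
      analyticAt_const)
  have h2 : AnalyticAt ℝ (fun A => fderiv ℝ S.pressure A (φ k)) (B + ∑ k, a k • φ k) :=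
    ((ContinuousLinearMap.apply ℝ ℝ (φ k)).analyticAt _).comp (S.analyticAt_pressure hS _).fderiv
  exact AnalyticAt.comp (f := fun a : Fin K → ℝ => B + ∑ k, a k • φ k) h2 h1

theorem injective_rotationVector_gibbsMeasure (S : PotentialSpace T X) (hS : S.SatisfiesRPF)
    (hT : ∀ x, (T ⁻¹' {x}).Finite) (hpos : S.GibbsFaithful) {K : ℕ} {φ : Fin K → X}
    (hφ : LinearIndependent ℝ (fun k => S.coboundariesAndConstants.mkQ (φ k))) (B : X) :
    Function.Injective fun a : Fin K → ℝ =>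
      S.rotationVector φ (S.gibbsMeasure (B + ∑ k, a k • φ k)) := by
  intro a b hab
  have hsub (a b : Fin K → ℝ) : B + ∑ k, b k • φ k - (B + ∑ k, a k • φ k) =
      ∑ k, (b - a) k • φ k := by
    simp [sub_smul]
  have hprob (A : X) := (S.gibbsMeasure_spec hS A).isProbabilityMeasure
  have h1 := S.pressure_add_integral_le hS hT hpos (B + ∑ k, a k • φ k) (B + ∑ k, b k • φ k)
  have h2 := (S.pressure_add_integral_le hS hT hpos (B + ∑ k, b k • φ k)
    (B + ∑ k, a k • φ k)).1
  rw [hsub, integral_ev_sum_smul] at h1 h2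
  simp only at hab
  -- Equal rotation vectors make the two linear terms opposite, so both Gibbs inequalities are
  -- equalities.
  have h3 : ∑ k, (a - b) k * S.rotationVector φ (S.gibbsMeasure (B + ∑ k, b k • φ k)) k =
      -∑ k, (b - a) k * S.rotationVector φ (S.gibbsMeasure (B + ∑ k, a k • φ k)) k := by
    rw [hab, ← Finset.sum_neg_distrib]
    refine Finset.sum_congr rfl fun k _ => ?_
    rw [Pi.sub_apply, Pi.sub_apply]
    ring
  rw [h3] at h2
  have h4 := S.eq_zero_of_sum_smul_mem hφ (h1.2 (by linarith [h1.1]))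
  exact (sub_eq_zero.1 h4).symm

/-- Pairing `dF(v)` with `v` gives the variance of `∑ v k • φ k`. If it vanishes, faithfulness puts
this sum in `𝒞`. -/
theorem eq_zero_of_fderiv_rotationVector_gibbsMeasure_eq_zero (S : PotentialSpace T X)
    (hS : S.SatisfiesRPF) (hpos : S.GibbsFaithful) {K : ℕ} {φ : Fin K → X}
    (hφ : LinearIndependent ℝ (fun k => S.coboundariesAndConstants.mkQ (φ k))) (B : X)
    (a v : Fin K → ℝ)
    (hv : fderiv ℝ (fun a : Fin K → ℝ =>
      S.rotationVector φ (S.gibbsMeasure (B + ∑ k, a k • φ k))) a v = 0) : v = 0 := by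
  set F := fun a : Fin K → ℝ => S.rotationVector φ (S.gibbsMeasure (B + ∑ k, a k • φ k)) with hF
  have hprob (A : X) := (S.gibbsMeasure_spec hS A).isProbabilityMeasure
  have hline : HasDerivAt (fun t : ℝ => a + t • v) v 0 := by
    simpa using ((hasDerivAt_id (0 : ℝ)).smul_const v).const_add a
  have h1 : HasDerivAt (fun t : ℝ => F (a + t • v)) 0 0 := by
    have h2 : HasFDerivAt F (fderiv ℝ F a) (a + (0 : ℝ) • v) := by
      rw [zero_smul, add_zero]
      exact (S.analyticAt_rotationVector_gibbsMeasure hS φ B a).differentiableAt.hasFDerivAt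
    exact (h2.comp_hasDerivAt (0 : ℝ) hline).congr_deriv hv
  have h2 : HasDerivAt (fun t : ℝ => ∑ k, v k * F (a + t • v) k) 0 0 := by
    have h3 := HasDerivAt.fun_sum (u := Finset.univ) fun k _ =>
      ((hasDerivAt_pi.1 h1) k).const_mul (v k)
    simpa using h3
  obtain ⟨w, c, h3⟩ := S.hasDerivAt_integral_gibbsMeasure hS (B + ∑ k, a k • φ k)
    (∑ k, v k • φ k)
  have h4 : (fun t : ℝ => ∑ k, v k * F (a + t • v) k) = fun t : ℝ =>
      ∫ x, S.ev (∑ k, v k • φ k) x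
        ∂(S.gibbsMeasure (B + ∑ k, a k • φ k + t • ∑ k, v k • φ k)) := by
    ext t
    rw [integral_ev_sum_smul]
    simp only [hF, Pi.add_apply, Pi.smul_apply, smul_eq_mul, add_smul, mul_smul,
      Finset.sum_add_distrib, Finset.smul_sum, add_assoc]
  rw [h4] at h2
  have h5 := hpos _ _ (fun x => by simpa using sq_nonneg _) (h3.unique h2)
  refine S.eq_zero_of_sum_smul_mem hφ ⟨-w, c, fun x => ?_⟩
  have h6 := congrFun (congrArg S.ev h5) x
  rw [map_pow, Pi.pow_apply, map_zero, Pi.zero_apply, sq_eq_zero_iff] at h6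
  simp only [map_sub, map_add, map_smul, _root_.map_one, Pi.sub_apply, Pi.add_apply,
    Pi.smul_apply, Pi.one_apply, smul_eq_mul, mul_one, koopman_apply, map_neg, Pi.neg_apply]
    at h6 ⊢
  linarith

theorem interior_rotationSet_subset_range (S : PotentialSpace T X)
    (hS : S.SatisfiesRPF) (hT : ∀ x, (T ⁻¹' {x}).Finite) {K : ℕ} (φ : Fin K → X) (B : X) :
    interior (S.rotationSet φ) ⊆ Set.range fun a : Fin K → ℝ =>
      S.rotationVector φ (S.gibbsMeasure (B + ∑ k, a k • φ k)) := by
  intro w hw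
  obtain ⟨r, hr, hball⟩ := Metric.nhds_basis_closedBall.mem_iff.1 (mem_interior_iff_mem_nhds.1 hw)
  obtain ⟨C, hC, hb⟩ := S.exists_abs_ev_le
  let q : (Fin K → ℝ) → ℝ := fun a => S.pressure (B + ∑ k, a k • φ k) - ∑ k, a k * w k
  have hq (a : Fin K → ℝ) : ‖a‖ * r + -(C * ‖B‖) ≤ q a := by
    -- Pushing `w` by `r` in the sign direction of `a` stays in the sup-norm ball, and pairing with
    -- `a` gains `r * ∑ |a k|`. This yields coercivity of `q`.
    have hmem : (w + r • fun k => ((SignType.sign (a k) : SignType) : ℝ)) ∈ S.rotationSet φ := by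
      refine hball ?_
      rw [mem_closedBall_iff_norm, add_sub_cancel_left, norm_smul, Real.norm_of_nonneg hr.le]
      refine mul_le_of_le_one_right hr.le ((pi_norm_le_iff_of_nonneg zero_le_one).2 fun k => ?_)
      rcases SignType.sign (a k) with _ | _ | _ <;> simp
    obtain ⟨μ, hμ, hμw⟩ := hmem
    have := hμ.1
    have h1 := S.integral_le_pressure hS hT (B + ∑ k, a k • φ k) hμ
    rw [← integralCLM_apply, map_add, integralCLM_apply, integralCLM_apply,
      integral_ev_sum_smul, hμw] at h1
    have h2 : |∫ x, S.ev B x ∂μ| ≤ C * ‖B‖ := by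
      simpa using norm_integral_le_of_norm_le_const (μ := μ) (f := S.ev B)
        (Filter.Eventually.of_forall fun x => hb B x)
    have h3 : ∑ k, a k * (w + r • fun k => ((SignType.sign (a k) : SignType) : ℝ)) k =
        ∑ k, a k * w k + (∑ k, |a k|) * r := by
      rw [Finset.sum_mul, ← Finset.sum_add_distrib]
      refine Finset.sum_congr rfl fun k _ => ?_
      rw [Pi.add_apply, Pi.smul_apply, smul_eq_mul, ← self_mul_sign (a k)]
      ring
    have h4 : ‖a‖ ≤ ∑ k, |a k| :=
      (pi_norm_le_iff_of_nonneg (Finset.sum_nonneg fun k _ => abs_nonneg _)).2 fun k =>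
        Finset.single_le_sum (f := fun k => |a k|) (fun k _ => abs_nonneg _) (Finset.mem_univ k)
    have h5 := mul_le_mul_of_nonneg_right h4 hr.le
    have h6 := neg_le_of_abs_le h2
    rw [h3] at h1
    simp only [q]
    linarith
  have hqd (a : Fin K → ℝ) : ∃ q' : (Fin K → ℝ) →L[ℝ] ℝ, HasFDerivAt q q' a ∧ ∀ v, q' v =
      ∑ k, v k * S.rotationVector φ (S.gibbsMeasure (B + ∑ k, a k • φ k)) k - ∑ k, v k * w k := by
    obtain ⟨P', hP, hP'⟩ := S.hasFDerivAt_pressure_family hS φ B a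
    let W : (Fin K → ℝ) →L[ℝ] ℝ :=
      ∑ k, (ContinuousLinearMap.proj (R := ℝ) (φ := fun _ : Fin K => ℝ) k).smulRight (w k)
    have hW (a : Fin K → ℝ) : W a = ∑ k, a k * w k := by simp [W]
    refine ⟨P' - W, ?_, fun v => by rw [_root_.sub_apply, hP', hW]⟩
    simp only [q, ← hW]
    exact hP.sub W.hasFDerivAt
  have hqc : Continuous q := continuous_iff_continuousAt.2 fun a =>
    (hqd a).choose_spec.1.continuousAt
  have hlim : Filter.Tendsto q (Filter.cocompact _) Filter.atTop :=
    Filter.tendsto_atTop_mono hq (Filter.tendsto_atTop_add_const_right _ _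
      (Filter.Tendsto.atTop_mul_const hr tendsto_norm_cocompact_atTop))
  obtain ⟨a, ha⟩ := hqc.exists_forall_le hlim
  obtain ⟨q', hq1, hq2⟩ := hqd a
  have hq0 : q' = 0 := IsLocalMin.hasFDerivAt_eq_zero (Filter.Eventually.of_forall ha) hq1
  refine ⟨a, funext fun k => ?_⟩
  have h1 := hq2 (Pi.single k 1)
  rw [hq0, _root_.zero_apply] at h1
  simp only [Pi.single_apply, ite_mul, one_mul, zero_mul, Finset.sum_ite_eq', Finset.mem_univ,
    if_true] at h1
  exact (sub_eq_zero.1 h1.symm)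

end

end PotentialSpace

theorem mainTheorem7 {Ω : Type*} [MetricSpace Ω] [CompactSpace Ω] [MeasurableSpace Ω]
    [BorelSpace Ω] (T : Ω → Ω) (hT : ∀ x, (T ⁻¹' {x}).Finite)
    {X : Type*} [NormedCommRing X] [NormedAlgebra ℝ X] [CompleteSpace X]
    (S : PotentialSpace T X) (hRPF : S.SatisfiesRPF) (hpos : S.GibbsFaithful)
    (hlarge : S.ApproximatesContinuous)
    {K : ℕ} (φ : Fin K → X)
    (hφ : LinearIndependent ℝ (fun k => S.coboundariesAndConstants.mkQ (φ k)))
    (B : X) :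
    IsAnalyticDiffeomorphismOnto
        (fun a : Fin K → ℝ => S.rotationVector φ (S.gibbsMeasure (B + ∑ k, a k • φ k)))
        (interior (S.rotationSet φ)) ∧
      (interior (S.rotationSet φ)).Nonempty ∧
      ∀ w ∈ interior (S.rotationSet φ), ∃ A : X,
        S.gibbsMeasure A ∈ invariantProbabilities T ∧
          S.rotationVector φ (S.gibbsMeasure A) = w := by
  have hinv (A : X) : S.gibbsMeasure A ∈ invariantProbabilities T :=
    (S.gibbsMeasure_spec hRPF A).mem_invariantProbabilities hlarge
  have hdiff := isAnalyticDiffeomorphismOnto_range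
    (S.analyticAt_rotationVector_gibbsMeasure hRPF φ B)
    (S.injective_rotationVector_gibbsMeasure hRPF hT hpos hφ B)
    (S.eq_zero_of_fderiv_rotationVector_gibbsMeasure_eq_zero hRPF hpos hφ B)
  have hsub := S.interior_rotationSet_subset_range hRPF hT φ B
  have hrange : (Set.range fun a : Fin K → ℝ =>
      S.rotationVector φ (S.gibbsMeasure (B + ∑ k, a k • φ k))) = interior (S.rotationSet φ) := by
    -- The range is open and consists of rotation vectors of invariant measures.
    refine Set.Subset.antisymm (interior_maximal ?_ hdiff.1) hsub
    rintro _ ⟨a, rfl⟩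
    exact ⟨_, hinv _, rfl⟩
  rw [hrange] at hdiff
  refine ⟨hdiff, ⟨_, hdiff.2.2.1 0⟩, fun w hw => ?_⟩
  obtain ⟨a, ha⟩ := hsub hw
  exact ⟨_, hinv _, ha⟩
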